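/- Theorem 1.3. Let $(A,\mathfrak m)$ be a (Noetherian) Cohen–Macaulay local domain of dimension $d\ge 1$, let $I$ be a nonzero ideal of $A$, and let $\mu(-)$ denote the minimal number of generators. Write $I=(a_1,\dots,a_r)$ with $r=\mu(I)$. Let $$J=\ker\bigl(A[X_1,\dots,X_r]\to \mathcal R(I)=A[It],\ X_i\mapsto a_it\bigr),$$ $$\widehat J=\ker\bigl(A[X_1,\dots,X_r,T]\to \widehat{\mathcal R}(I)=A[It,t^{-1}],\ X_i\mapsto a_it,\ T\mapsto t^{-1}\bigr)$$ be the defining ideals of the Rees algebra and of the extended Rees algebra of $I$. Let $H_1(J)$ and $H_1(\widehat J)$ denote the first Koszul homology modules of $J$ and $\widehat J$ with respect to any generating sequences of lengths $\mu(J)$ and $\mu(\widehat J)$ respectively; they are modules over the domains $\mathcal R(I)$ and $\widehat{\mathcal R}(I)$ respectively, and ranks are taken over these. Then 1. $\operatorname{rank} H_1(\widehat J)=\mu(\widehat J)-\mu(I)$; 2. $\operatorname{rank} H_1(J)=\mu(J)-\mu(I)+1$. -/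

import Mathlib

open scoped LaurentPolynomial

noncomputable section

/-- A Noetherian local ring `A` is Cohen-Macaulay when its depth equals its dimension, that is, when
its maximal ideal contains an `A`-regular sequence of length `dim A`. -/
class IsCohenMacaulayLocal (A : Type*) [CommRing A] [IsLocalRing A] : Prop where
  exists_isRegular : ∃ rs : List A, (∀ x ∈ rs, x ∈ IsLocalRing.maximalIdeal A) ∧
    RingTheory.Sequence.IsRegular A rs ∧ ((rs.length : ℕ∞) : WithBot ℕ∞) = ringKrullDim A

section Koszul

variable {S : Type*} [CommRing S] {s : ℕ}

/-- The linear form `S ^ s → S`, `e i ↦ u i`. -/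
def koszulForm (u : Fin s → S) : Module.Dual S (Fin s → S) :=
  Fintype.linearCombination S u

/-- The Koszul differential on the exterior algebra of `S ^ s`: the contraction with the linear form
`e i ↦ u i`, that is
`e i₁ ∧ ⋯ ∧ e iₙ ↦ ∑ₖ (-1) ^ (k - 1) • u iₖ • (e i₁ ∧ ⋯ (omit e iₖ) ⋯ ∧ e iₙ)`. -/
def koszulDifferential (u : Fin s → S) :
    ExteriorAlgebra S (Fin s → S) →ₗ[S] ExteriorAlgebra S (Fin s → S) :=
  CliffordAlgebra.contractLeft (Q := (0 : QuadraticForm S (Fin s → S))) (koszulForm u)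

theorem koszulDifferential_ι_mul (u : Fin s → S) (x : Fin s → S)
    (y : ExteriorAlgebra S (Fin s → S)) :
    koszulDifferential u (ExteriorAlgebra.ι S x * y) =
      koszulForm u x • y - ExteriorAlgebra.ι S x * koszulDifferential u y :=
  CliffordAlgebra.contractLeft_ι_mul _ x y

theorem koszulDifferential_comp_self (u : Fin s → S) (x : ExteriorAlgebra S (Fin s → S)) :
    koszulDifferential u (koszulDifferential u x) = 0 :=
  CliffordAlgebra.contractLeft_contractLeft (koszulForm u) x

/-- The `n`-cycles of the Koszul complex of `u`, whose term in degree `n` is `⋀ⁿ (S ^ s)`. -/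
def koszulCycles (u : Fin s → S) (n : ℕ) : Submodule S (ExteriorAlgebra S (Fin s → S)) :=
  (⋀[S]^n (Fin s → S)) ⊓ LinearMap.ker (koszulDifferential u)

/-- The `n`-boundaries of the Koszul complex of `u`. -/
def koszulBoundaries (u : Fin s → S) (n : ℕ) : Submodule S (ExteriorAlgebra S (Fin s → S)) :=
  (⋀[S]^(n + 1) (Fin s → S)).map (koszulDifferential u)

/-- The `n`-th Koszul homology `H_n(u₁, …, u_s; S)`: cycles modulo boundaries. -/
abbrev KoszulHomology (u : Fin s → S) (n : ℕ) : Type _ :=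
  koszulCycles u n ⧸ (koszulBoundaries u n).submoduleOf (koszulCycles u n)

theorem ι_mul_mem_exteriorPower (n : ℕ) (x : Fin s → S) {y : ExteriorAlgebra S (Fin s → S)}
    (hy : y ∈ ⋀[S]^n (Fin s → S)) :
    ExteriorAlgebra.ι S x * y ∈ ⋀[S]^(n + 1) (Fin s → S) := by
  change _ ∈ LinearMap.range (ExteriorAlgebra.ι S) ^ (n + 1)
  rw [pow_succ']
  exact Submodule.mul_mem_mul ⟨x, rfl⟩ hy

/-- The Koszul differential lowers the degree by one. -/
theorem koszulDifferential_mem (u : Fin s → S) (n : ℕ) {y : ExteriorAlgebra S (Fin s → S)}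
    (hy : y ∈ ⋀[S]^(n + 1) (Fin s → S)) :
    koszulDifferential u y ∈ ⋀[S]^n (Fin s → S) := by
  induction n generalizing y with
  | zero =>
    change y ∈ LinearMap.range (ExteriorAlgebra.ι S) ^ (0 + 1) at hy
    change _ ∈ LinearMap.range (ExteriorAlgebra.ι S) ^ 0
    rw [zero_add, pow_one] at hy
    obtain ⟨x, rfl⟩ := hy
    rw [pow_zero]
    exact Submodule.mem_one.2 ⟨koszulForm u x,
      (CliffordAlgebra.contractLeft_ι (d := koszulForm u) (0 : QuadraticForm S (Fin s → S)) x).symm⟩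
  | succ n ih =>
    change y ∈ LinearMap.range (ExteriorAlgebra.ι S) ^ (n + 1 + 1) at hy
    rw [pow_succ'] at hy
    refine Submodule.mul_induction_on hy ?_ ?_
    · rintro _ ⟨x, rfl⟩ z hz
      rw [koszulDifferential_ι_mul]
      exact Submodule.sub_mem _ (Submodule.smul_mem _ _ hz) (ι_mul_mem_exteriorPower n x (ih hz))
    · intro a b ha hb
      rw [map_add]
      exact Submodule.add_mem _ ha hb

theorem koszulBoundaries_le_koszulCycles (u : Fin s → S) (n : ℕ) :
    koszulBoundaries u n ≤ koszulCycles u n := by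
  rintro _ ⟨y, hy, rfl⟩
  exact ⟨koszulDifferential_mem u n hy, koszulDifferential_comp_self u y⟩

/-- The ideal generated by `u` annihilates the Koszul homology of `u`. -/
theorem koszulHomology_isTorsionBySet (u : Fin s → S) (n : ℕ) :
    Module.IsTorsionBySet S (KoszulHomology u n) (Ideal.span (Set.range u) : Set S) := by
  refine (Module.isTorsionBySet_iff_is_torsion_by_span _).1 ?_
  rintro h ⟨_, i, rfl⟩
  induction h using Submodule.Quotient.induction_on with
  | _ z =>
    change u i • Submodule.Quotient.mk z = 0
    rw [← Submodule.Quotient.mk_smul, Submodule.Quotient.mk_eq_zero]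
    change _ ∈ koszulBoundaries u n
    refine ⟨ExteriorAlgebra.ι S (Pi.single i 1 : Fin s → S) * z.1, ι_mul_mem_exteriorPower n _ z.2.1, ?_⟩
    have h0 : koszulDifferential u (z : ExteriorAlgebra S (Fin s → S)) = 0 := z.2.2
    rw [koszulDifferential_ι_mul, h0, mul_zero, sub_zero]
    simp [koszulForm]

/-- If `f : S → R` is a surjective ring homomorphism whose kernel is generated by `u`, then the Koszul
homology of `u` is a module over `R ≅ S / (u)`. -/
@[reducible]
def koszulHomologyModule {R : Type*} [CommRing R] (f : S →+* R) (hf : Function.Surjective f)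
    (u : Fin s → S) (hu : Ideal.span (Set.range u) = RingHom.ker f) (n : ℕ) :
    Module R (KoszulHomology u n) :=
  letI : Module (S ⧸ RingHom.ker f) (KoszulHomology u n) :=
    Module.IsTorsionBySet.module (hu ▸ koszulHomology_isTorsionBySet u n)
  Module.compHom (KoszulHomology u n)
    (RingHom.quotientKerEquivOfSurjective hf).symm.toRingHom

theorem koszulHomologyModule_smul {R : Type*} [CommRing R] (f : S →+* R)
    (hf : Function.Surjective f) (u : Fin s → S)
    (hu : Ideal.span (Set.range u) = RingHom.ker f) (n : ℕ) (c : S) (h : KoszulHomology u n) :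
    letI := koszulHomologyModule f hf u hu n
    f c • h = c • h := by
  let _ : Module (S ⧸ RingHom.ker f) (KoszulHomology u n) :=
    Module.IsTorsionBySet.module (hu ▸ koszulHomology_isTorsionBySet u n)
  change (RingHom.quotientKerEquivOfSurjective hf).symm (f c) • h = c • h
  have : (RingHom.quotientKerEquivOfSurjective hf).symm (f c) =
      Ideal.Quotient.mk (RingHom.ker f) c := by
    rw [RingEquiv.symm_apply_eq]
    rfl
  rw [this]
  rfl

/-- The rank over `R` of the `n`-th Koszul homology of `u`, where `R ≅ S / (u)` through `f`. -/
def koszulHomologyRank {R : Type*} [CommRing R] (f : S →+* R) (hf : Function.Surjective f)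
    (u : Fin s → S) (hu : Ideal.span (Set.range u) = RingHom.ker f) (n : ℕ) : Cardinal :=
  letI := koszulHomologyModule f hf u hu n
  Module.rank R (KoszulHomology u n)

end Koszul

section Rees

variable {A : Type*} [CommRing A] {I : Ideal A} {r : ℕ}

theorem mem_of_span_range_eq {a : Fin r → A} (ha : Ideal.span (Set.range a) = I) (i : Fin r) :
    a i ∈ I :=
  ha ▸ Ideal.subset_span ⟨i, rfl⟩

/-- The presentation `A[X₁, …, X_r] → A[It]`, `X i ↦ a i * t`, of the Rees algebra of
`I = (a₁, …, a_r)`. -/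
def reesPresentation (a : Fin r → A) (ha : Ideal.span (Set.range a) = I) :
    MvPolynomial (Fin r) A →ₐ[A] reesAlgebra I :=
  MvPolynomial.aeval fun i =>
    ⟨Polynomial.monomial 1 (a i),
      reesAlgebra.monomial_mem.2 (by rw [pow_one]; exact mem_of_span_range_eq ha i)⟩

theorem reesPresentation_surjective (a : Fin r → A) (ha : Ideal.span (Set.range a) = I) :
    Function.Surjective (reesPresentation a ha) := by
  have hX (i : Fin r) : ((reesPresentation a ha (MvPolynomial.X i) : reesAlgebra I) :
      Polynomial A) = Polynomial.monomial 1 (a i) := by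
    simp [reesPresentation]
  have key : reesAlgebra I ≤ ((reesAlgebra I).val.comp (reesPresentation a ha)).range := by
    refine (adjoin_monomial_eq_reesAlgebra I).symm.le.trans (Algebra.adjoin_le ?_)
    change (Submodule.map (Polynomial.monomial 1 : A →ₗ[A] Polynomial A) I) ≤
      Subalgebra.toSubmodule ((reesAlgebra I).val.comp (reesPresentation a ha)).range
    refine (congrArg _ ha).symm.le.trans ?_
    rw [Ideal.span, Submodule.map_span, Submodule.span_le]
    rintro _ ⟨_, ⟨i, rfl⟩, rfl⟩
    exact ⟨MvPolynomial.X i, hX i⟩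
  intro y
  obtain ⟨p, hp⟩ := key y.2
  exact ⟨p, Subtype.ext hp⟩

/-- The defining ideal `J` of the Rees algebra. -/
def reesIdeal (a : Fin r → A) (ha : Ideal.span (Set.range a) = I) :
    Ideal (MvPolynomial (Fin r) A) :=
  RingHom.ker (reesPresentation a ha).toRingHom

/-- The extended Rees algebra `A[It, t⁻¹]`, as a subalgebra of `A[t, t⁻¹]`. -/
def extendedReesAlgebra (I : Ideal A) : Subalgebra A A[T;T⁻¹] :=
  Algebra.adjoin A ({x | ∃ b ∈ I, x = LaurentPolynomial.C b * LaurentPolynomial.T 1} ∪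
    {LaurentPolynomial.T (-1)})

/-- The presentation `A[X₁, …, X_r, T] → A[It, t⁻¹]`, `X i ↦ a i * t`, `T ↦ t⁻¹`, of the extended
Rees algebra of `I = (a₁, …, a_r)`. The variable `X i` is indexed by `some i` and `T` by `none`. -/
def extendedReesPresentation (a : Fin r → A) (ha : Ideal.span (Set.range a) = I) :
    MvPolynomial (Option (Fin r)) A →ₐ[A] extendedReesAlgebra I :=
  MvPolynomial.aeval fun j => match j with
    | some i => ⟨LaurentPolynomial.C (a i) * LaurentPolynomial.T 1,
        Algebra.subset_adjoin (Or.inl ⟨a i, mem_of_span_range_eq ha i, rfl⟩)⟩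
    | none => ⟨LaurentPolynomial.T (-1), Algebra.subset_adjoin (Or.inr rfl)⟩

theorem extendedReesPresentation_surjective (a : Fin r → A)
    (ha : Ideal.span (Set.range a) = I) :
    Function.Surjective (extendedReesPresentation a ha) := by
  have hX (i : Fin r) : ((extendedReesPresentation a ha (MvPolynomial.X (some i)) :
      extendedReesAlgebra I) : A[T;T⁻¹]) =
      LaurentPolynomial.C (a i) * LaurentPolynomial.T 1 := by
    simp [extendedReesPresentation]
  have hT : ((extendedReesPresentation a ha (MvPolynomial.X none) :
      extendedReesAlgebra I) : A[T;T⁻¹]) = LaurentPolynomial.T (-1) := by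
    simp [extendedReesPresentation]
  have key : extendedReesAlgebra I ≤
      ((extendedReesAlgebra I).val.comp (extendedReesPresentation a ha)).range := by
    refine Algebra.adjoin_le ?_
    rintro _ (⟨b, hb, rfl⟩ | rfl)
    · rw [← ha] at hb
      induction hb using Submodule.span_induction with
      | mem x hx =>
        obtain ⟨i, rfl⟩ := hx
        exact ⟨MvPolynomial.X (some i), hX i⟩
      | zero =>
        rw [map_zero, zero_mul]
        exact zero_mem _
      | add x y _ _ hx hy =>
        rw [map_add, add_mul]
        exact add_mem hx hy
      | smul c x _ hx =>
        rw [smul_eq_mul, map_mul, mul_assoc]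
        exact mul_mem (Subalgebra.algebraMap_mem _ c) hx
    · exact ⟨MvPolynomial.X none, hT⟩
  intro y
  obtain ⟨p, hp⟩ := key y.2
  exact ⟨p, Subtype.ext hp⟩

/-- The defining ideal `Ĵ` of the extended Rees algebra. -/
def extendedReesIdeal (a : Fin r → A) (ha : Ideal.span (Set.range a) = I) :
    Ideal (MvPolynomial (Option (Fin r)) A) :=
  RingHom.ker (extendedReesPresentation a ha).toRingHom

end Rees

end

universe v w

/-! Let `f : S → R` present either algebra, with `P = ker f = (u₁, …, uₙ)`. At the generic point of
`R`, `P` should be generated by a regular sequence of known length `m`. Then `P/P²` has rank `m`,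
and `H₁(u) → Rⁿ → P/P² → 0`, with torsion kernel on the left, gives `rank H₁(u) = n - m`.

The regular sequences are explicit. For the extended algebra take `T Xᵢ - aᵢ`, so `m = r`; for the
Rees algebra fix `a_o ≠ 0` and take `a_o Xᵢ - aᵢ X_o` with `i ≠ o`, so `m = r - 1`. Both have the
shape `s Xᵢ - bᵢ` with `s`, `bᵢ` free of the eliminated variables. Inverting `s` solves for those
variables, and the remaining polynomial ring (`A[T]` or `A[X_o]`) embeds in `R`.

No localization is formed: denominators are elements `t` with `f t ≠ 0`, and `P/P²` is replaced by
`R^m`. `koszulHomologyRank_one_add_card` computes the rank from generic data;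
`koszulHomologyRank_one_add_card_of_linear` supplies these data for the linear shape. -/

/-- If `φ : H → M` and `D : M → N` have torsion homology, torsion kernel and torsion cokernel, then
`rank H + rank N = rank M`. -/
theorem rank_add_rank_eq_of_exact_up_to_torsion {R : Type w} [CommRing R] [IsDomain R]
    {H M N : Type v} [AddCommGroup H] [AddCommGroup M] [AddCommGroup N]
    [Module R H] [Module R M] [Module R N] [Module.IsTorsionFree R M] [Module.IsTorsionFree R N]
    (φ : H →ₗ[R] M) (D : M →ₗ[R] N)
    (hker : ∀ x, φ x = 0 → ∃ c : R, c ≠ 0 ∧ c • x = 0)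
    (hcomp : ∀ x, D (φ x) = 0) {c : R} (hc : c ≠ 0)
    (hexact : ∀ y, D y = 0 → c • y ∈ LinearMap.range φ)
    (hsurj : ∀ z, c • z ∈ LinearMap.range D) :
    Module.rank R H + Module.rank R N = Module.rank R M := by
  have h1 : Module.rank R (LinearMap.ker φ) = 0 := by
    rw [rank_eq_zero_iff]
    rintro ⟨x, hx⟩
    obtain ⟨b, hb, hbx⟩ := hker x hx
    exact ⟨b, hb, Subtype.ext hbx⟩
  have h2 : Module.rank R (LinearMap.range φ) = Module.rank R H := by
    rw [← LinearMap.rank_range_add_rank_ker φ, h1, add_zero]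
  have h3 : Module.rank R (LinearMap.range φ) = Module.rank R (LinearMap.ker D) := by
    apply le_antisymm
    · apply Submodule.rank_mono
      rintro _ ⟨x, rfl⟩
      exact hcomp x
    -- Multiplication by `c` embeds `ker D` into `range φ`, since `M` is torsion-free.
    · let g : LinearMap.ker D →ₗ[R] LinearMap.range φ :=
        LinearMap.codRestrict _ (c • (LinearMap.ker D).subtype) fun y => hexact y y.2
      refine LinearMap.rank_le_of_injective g fun x y hxy => Subtype.ext ?_
      exact smul_right_injective M hc (congrArg Subtype.val hxy)
  have h4 : Module.rank R (LinearMap.range D) = Module.rank R N := by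
    apply le_antisymm (Submodule.rank_le _)
    let g : N →ₗ[R] LinearMap.range D :=
      LinearMap.codRestrict _ (c • LinearMap.id) fun y => hsurj y
    refine LinearMap.rank_le_of_injective g fun x y hxy => ?_
    exact smul_right_injective N hc (congrArg Subtype.val hxy)
  rw [← LinearMap.rank_range_add_rank_ker D, h4, ← h3, h2, add_comm]

/-! ### First Koszul homology as relations modulo Koszul relations -/

section KoszulRelations

variable {S : Type*} [CommRing S] {ι κ : Type*} [Fintype ι] [Fintype κ]

/-- The Koszul relations on a finite family `u` of elements of a ring. -/
def koszulRelations (u : ι → S) : Submodule S (ι → S) :=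
  Submodule.span S {z | ∃ x y : ι → S,
    z = Fintype.linearCombination S u x • y - Fintype.linearCombination S u y • x}

theorem koszulRelations_le_comap {u : ι → S} {v : κ → S} (G : (κ → S) →ₗ[S] (ι → S))
    (hG : ∀ x, Fintype.linearCombination S u (G x) = Fintype.linearCombination S v x) :
    koszulRelations v ≤ (koszulRelations u).comap G := by
  refine Submodule.span_le.2 ?_
  rintro _ ⟨x, y, rfl⟩
  refine Submodule.subset_span ⟨G x, G y, ?_⟩
  simp only [map_sub, map_smul, hG]

/-- Writing `c = ∑ xₖ uₖ`, the Koszul relation of `x` and `y` collapses to `c • y`. -/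
theorem smul_mem_koszulRelations {u : ι → S} {c : S} (hc : c ∈ Ideal.span (Set.range u))
    {y : ι → S} (hy : Fintype.linearCombination S u y = 0) : c • y ∈ koszulRelations u := by
  obtain ⟨x, rfl⟩ := Ideal.mem_span_range_iff_exists_fun.1 hc
  refine Submodule.subset_span ⟨x, y, ?_⟩
  rw [hy, zero_smul, sub_zero]
  rfl

/-- This makes reduction of coordinates modulo `(u)` well defined on `H₁(u)`. -/
theorem apply_mem_of_mem_koszulRelations {u : ι → S} {z : ι → S} (hz : z ∈ koszulRelations u)
    (i : ι) : z i ∈ Ideal.span (Set.range u) := by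
  have key : ∀ x, Fintype.linearCombination S u x ∈ Ideal.span (Set.range u) := fun x =>
    Ideal.mem_span_range_iff_exists_fun.2 ⟨x, rfl⟩
  induction hz using Submodule.span_induction with
  | mem z hz =>
    obtain ⟨x, y, rfl⟩ := hz
    exact sub_mem (Ideal.mul_mem_right _ _ (key x)) (Ideal.mul_mem_right _ _ (key y))
  | zero => exact zero_mem _
  | add x y _ _ hx hy => exact add_mem hx hy
  | smul c x _ hx => exact Ideal.mul_mem_left _ _ hx

theorem mem_koszulCycles_one {s : ℕ} (u : Fin s → S) (z : ExteriorAlgebra S (Fin s → S)) :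
    z ∈ koszulCycles u 1 ↔
      ∃ x, Fintype.linearCombination S u x = 0 ∧ ExteriorAlgebra.ι S x = z := by
  have hd (x : Fin s → S) : koszulDifferential u (ExteriorAlgebra.ι S x) =
      algebraMap S _ (Fintype.linearCombination S u x) :=
    CliffordAlgebra.contractLeft_ι (d := koszulForm u) (0 : QuadraticForm S (Fin s → S)) x
  constructor
  · rintro ⟨hz, hz'⟩
    change z ∈ LinearMap.range (ExteriorAlgebra.ι S) ^ 1 at hz
    rw [pow_one] at hz
    obtain ⟨x, rfl⟩ := hz
    refine ⟨x, ?_, rfl⟩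
    rw [SetLike.mem_coe, LinearMap.mem_ker, hd] at hz'
    exact (ExteriorAlgebra.algebraMap_eq_zero_iff _ _).1 hz'
  · rintro ⟨x, hx, rfl⟩
    refine ⟨?_, ?_⟩
    · change _ ∈ LinearMap.range (ExteriorAlgebra.ι S) ^ 1
      rw [pow_one]
      exact ⟨x, rfl⟩
    · rw [SetLike.mem_coe, LinearMap.mem_ker, hd, hx, map_zero]

theorem ι_mem_koszulBoundaries_one {s : ℕ} (u : Fin s → S) (x : Fin s → S) :
    ExteriorAlgebra.ι S x ∈ koszulBoundaries u 1 ↔ x ∈ koszulRelations u := by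
  have hd (x y : Fin s → S) : koszulDifferential u (ExteriorAlgebra.ι S x * ExteriorAlgebra.ι S y) =
      ExteriorAlgebra.ι S (Fintype.linearCombination S u x • y -
        Fintype.linearCombination S u y • x) := by
    have h : koszulDifferential u (ExteriorAlgebra.ι S y) =
        algebraMap S _ (Fintype.linearCombination S u y) :=
      CliffordAlgebra.contractLeft_ι (d := koszulForm u) (0 : QuadraticForm S (Fin s → S)) y
    rw [koszulDifferential_ι_mul, h, map_sub, map_smul, map_smul, ← Algebra.commutes,
      ← Algebra.smul_def]
    rfl
  have key : koszulBoundaries u 1 = (koszulRelations u).map (ExteriorAlgebra.ι S) := by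
    apply le_antisymm
    · rintro _ ⟨z, hz, rfl⟩
      change z ∈ LinearMap.range (ExteriorAlgebra.ι S) ^ 2 at hz
      rw [pow_two] at hz
      refine Submodule.mul_induction_on hz ?_ ?_
      · rintro _ ⟨x, rfl⟩ _ ⟨y, rfl⟩
        exact ⟨_, Submodule.subset_span ⟨x, y, rfl⟩, (hd x y).symm⟩
      · intro a b ha hb
        rw [map_add]
        exact add_mem ha hb
    · rw [koszulRelations, Submodule.map_span, Submodule.span_le]
      rintro _ ⟨_, ⟨x, y, rfl⟩, rfl⟩
      refine ⟨ExteriorAlgebra.ι S x * ExteriorAlgebra.ι S y, ?_, hd x y⟩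
      change _ ∈ LinearMap.range (ExteriorAlgebra.ι S) ^ 2
      rw [pow_two]
      exact Submodule.mul_mem_mul ⟨x, rfl⟩ ⟨y, rfl⟩
  rw [key]
  exact ExteriorAlgebra.ι_leftInverse.injective.mem_set_image

end KoszulRelations

/-! ### Rank of `H₁` from generic generators -/

/-- Reducing the coordinates of `1`-cycles along `f : S → R` gives an `R`-linear map
`H₁(u) → R ^ s`. -/
theorem exists_koszulHomology_one_linearMap {S : Type*} [CommRing S] {R : Type*} [CommRing R]
    {s : ℕ} (f : S →+* R) (hf : Function.Surjective f) (u : Fin s → S)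
    (hu : Ideal.span (Set.range u) = RingHom.ker f) :
    letI := koszulHomologyModule f hf u hu 1
    ∃ φ : KoszulHomology u 1 →ₗ[R] (Fin s → R),
      ∀ (x : Fin s → S) (hx : ExteriorAlgebra.ι S x ∈ koszulCycles u 1),
        φ (Submodule.Quotient.mk ⟨_, hx⟩) = fun k => f (x k) := by
  let _ := koszulHomologyModule f hf u hu 1
  let _ : Algebra S R := f.toAlgebra
  let ψ : koszulCycles u 1 →ₗ[S] (Fin s → R) :=
    (Algebra.linearMap S R).compLeft (Fin s) ∘ₗ ExteriorAlgebra.ιInv ∘ₗ (koszulCycles u 1).subtype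
  have hψ (x : Fin s → S) (hx : ExteriorAlgebra.ι S x ∈ koszulCycles u 1) :
      ψ ⟨_, hx⟩ = fun k => f (x k) := by
    funext k
    change f (ExteriorAlgebra.ιInv (ExteriorAlgebra.ι S x) k) = _
    rw [ExteriorAlgebra.ι_leftInverse]
  have hle : (koszulBoundaries u 1).submoduleOf (koszulCycles u 1) ≤ LinearMap.ker ψ := by
    rintro ⟨z, hz⟩ hzB
    obtain ⟨x, -, rfl⟩ := (mem_koszulCycles_one u z).1 hz
    rw [LinearMap.mem_ker, hψ]
    funext k
    have := apply_mem_of_mem_koszulRelations ((ι_mem_koszulBoundaries_one u x).1 hzB) k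
    rw [hu] at this
    exact this
  refine ⟨{ toFun := Submodule.liftQ _ ψ hle, map_add' := map_add _, map_smul' := ?_ }, ?_⟩
  · intro c x
    obtain ⟨c, rfl⟩ := hf c
    have := koszulHomologyModule_smul f hf u hu 1 c x
    rw [this, map_smul]
    funext k
    rfl
  · intro x hx
    exact hψ x hx

/-- If the kernel of `f : S → R` onto a domain is generically generated by a family `v`
whose relations are generically the Koszul relations, then
`rank H₁(u) + #v = #u` for every finite generating family `u` of the kernel. -/
theorem koszulHomologyRank_one_add_card {S R : Type v} [CommRing S] [CommRing R] [IsDomain R]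
    {s : ℕ} (f : S →+* R) (hf : Function.Surjective f) (u : Fin s → S)
    (hu : Ideal.span (Set.range u) = RingHom.ker f) {κ : Type} [Fintype κ] (v : κ → S)
    (hv : ∀ i, f (v i) = 0)
    (hgen : ∀ p, f p = 0 → ∃ t, f t ≠ 0 ∧ t * p ∈ Ideal.span (Set.range v))
    (hrel : ∀ x, Fintype.linearCombination S v x = 0 →
      ∃ t, f t ≠ 0 ∧ t • x ∈ koszulRelations v) :
    koszulHomologyRank f hf u hu 1 + (Fintype.card κ : Cardinal) = (s : Cardinal) := by
  classical
  have hu0 (k : Fin s) : f (u k) = 0 := by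
    have : u k ∈ RingHom.ker f := hu ▸ Ideal.subset_span ⟨k, rfl⟩
    exact this
  have hvle : Ideal.span (Set.range v) ≤ RingHom.ker f := by
    rw [Ideal.span_le]
    rintro _ ⟨i, rfl⟩
    exact hv i
  choose t0 ht0 ht0' using fun k => hgen (u k) (hu0 k)
  -- The product of the individual denominators serves all `u k`; it stays nonzero in the domain
  -- `R`.
  obtain ⟨t, ht, htu⟩ : ∃ t, f t ≠ 0 ∧ ∀ k, t * u k ∈ Ideal.span (Set.range v) := by
    refine ⟨∏ k, t0 k, ?_, fun k => ?_⟩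
    · rw [map_prod]
      exact Finset.prod_ne_zero_iff.2 fun k _ => ht0 k
    · rw [← Finset.prod_erase_mul _ _ (Finset.mem_univ k), mul_assoc]
      exact Ideal.mul_mem_left _ _ (ht0' k)
  choose m hm using fun k => Ideal.mem_span_range_iff_exists_fun.1 (htu k)
  choose l hl using fun i => Ideal.mem_span_range_iff_exists_fun.1
    (show v i ∈ Ideal.span (Set.range u) from hu ▸ hv i)
  -- `F` writes `t • u` in terms of `v`, and `G` writes `v` in terms of `u`: generically they are
  -- inverse changes of generators of `P`.
  let F : (Fin s → S) →ₗ[S] (κ → S) := Fintype.linearCombination S m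
  let G : (κ → S) →ₗ[S] (Fin s → S) := Fintype.linearCombination S l
  have hF (x : Fin s → S) : Fintype.linearCombination S v (F x) =
      t * Fintype.linearCombination S u x := by
    simp only [F, Fintype.linearCombination_apply, map_sum, map_smul, Finset.mul_sum]
    refine Finset.sum_congr rfl fun k _ => ?_
    have := hm k
    simp only [smul_eq_mul] at this ⊢
    rw [this]; ring
  have hG (x : κ → S) : Fintype.linearCombination S u (G x) =
      Fintype.linearCombination S v x := by
    simp only [G, Fintype.linearCombination_apply, map_sum, map_smul]
    refine Finset.sum_congr rfl fun k _ => ?_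
    rw [← hl k]
    rfl
  -- Generically, the classes of `v` are independent in `P/P²`.
  have hrel' (x : κ → S) (hx : Fintype.linearCombination S v x = 0) (i : κ) : f (x i) = 0 := by
    obtain ⟨t', ht', h⟩ := hrel x hx
    have := hvle (apply_mem_of_mem_koszulRelations h i)
    rw [RingHom.mem_ker, Pi.smul_apply, smul_eq_mul, map_mul] at this
    exact (mul_eq_zero.1 this).resolve_left ht'
  have hGmem (x : κ → S) (hx : ∀ i, f (x i) = 0) (k : Fin s) : f (G x k) = 0 := by
    simp [G, Fintype.linearCombination_apply, hx]
  let D : (Fin s → R) →ₗ[R] (κ → R) := Fintype.linearCombination R fun k i => f (m k i)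
  have hD (x : Fin s → S) : D (fun k => f (x k)) = fun i => f (F x i) := by
    funext i
    simp [D, F, Fintype.linearCombination_apply]
  let _ := koszulHomologyModule f hf u hu 1
  have hsmul (c : S) (h : KoszulHomology u 1) : f c • h = c • h :=
    koszulHomologyModule_smul f hf u hu 1 c h
  obtain ⟨φ, hφ⟩ := exists_koszulHomology_one_linearMap f hf u hu
  have hlift {n : Type} (y : n → R) : ∃ x : n → S, y = fun k => f (x k) := by
    choose x hx using fun k => hf (y k)
    exact ⟨x, funext fun k => (hx k).symm⟩
  have hcyc (x : Fin s → S) (hx : Fintype.linearCombination S u x = 0) :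
      ExteriorAlgebra.ι S x ∈ koszulCycles u 1 :=
    (mem_koszulCycles_one u _).2 ⟨x, hx, rfl⟩
  have main := rank_add_rank_eq_of_exact_up_to_torsion φ D ?_ ?_ ht ?_ ?_
  · rw [rank_fun', rank_fin_fun] at main
    exact main
  · intro h hh
    induction h using Submodule.Quotient.induction_on with
    | _ z =>
    obtain ⟨z, hz⟩ := z
    obtain ⟨x, hx, rfl⟩ := (mem_koszulCycles_one u z).1 hz
    rw [hφ] at hh
    -- Split `t' t x = t' (t x - G (F x)) + G (t' F x)`; both summands are Koszul relations of `u`.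
    obtain ⟨t', ht', h⟩ := hrel (F x) (by rw [hF, hx, mul_zero])
    have h1 : t' • G (F x) ∈ koszulRelations u := by
      rw [← map_smul]
      exact koszulRelations_le_comap G hG h
    have h2 : t • x - G (F x) ∈ koszulRelations u := by
      -- `E` takes every vector to a relation of `u`. As the coordinates of `x` lie in `(u)`, `E x`
      -- is a sum of multiples of relations by elements of `(u)`.
      let E : (Fin s → S) →ₗ[S] (Fin s → S) := t • LinearMap.id - G ∘ₗ F
      have hE : ∀ y, Fintype.linearCombination S u (E y) = 0 := by
        intro y
        simp [E, hG, hF]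
      change E x ∈ _
      rw [pi_eq_sum_univ x, map_sum]
      refine sum_mem fun k _ => ?_
      rw [map_smul]
      refine smul_mem_koszulRelations ?_ (hE _)
      rw [hu]
      exact congrFun hh k
    refine ⟨f (t' * t), by rw [map_mul]; exact mul_ne_zero ht' ht, ?_⟩
    rw [hsmul, ← Submodule.Quotient.mk_smul, Submodule.Quotient.mk_eq_zero]
    change (t' * t) • ExteriorAlgebra.ι S x ∈ koszulBoundaries u 1
    rw [← map_smul, ι_mem_koszulBoundaries_one]
    have := add_mem (Submodule.smul_mem _ t' h2) h1
    rwa [smul_sub, sub_add_cancel, smul_smul] at this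
  · intro h
    induction h using Submodule.Quotient.induction_on with
    | _ z =>
    obtain ⟨z, hz⟩ := z
    obtain ⟨x, hx, rfl⟩ := (mem_koszulCycles_one u z).1 hz
    rw [hφ, hD]
    funext i
    exact hrel' _ (by rw [hF, hx, mul_zero]) i
  · intro y hy
    obtain ⟨x, rfl⟩ := hlift y
    rw [hD] at hy
    -- This cycle reduces to `t` times the class of `x`, because `F x`, hence `G (F x)`, vanishes
    -- under `f`.
    have h0 : Fintype.linearCombination S u (t • x - G (F x)) = 0 := by
      simp [hG, hF]
    refine ⟨Submodule.Quotient.mk ⟨_, hcyc _ h0⟩, ?_⟩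
    rw [hφ]
    funext k
    simp [hGmem (F x) (congrFun hy) k]
  · intro y
    obtain ⟨x, rfl⟩ := hlift y
    refine ⟨fun k => f (G x k), ?_⟩
    rw [hD]
    funext i
    have := hrel' (F (G x) - t • x) (by simp [hF, hG]) i
    rw [Pi.sub_apply, map_sub, sub_eq_zero] at this
    rw [this]
    simp

/-! ### Regular sequences up to powers of `s` -/

/-- If, up to powers of `s`, each `v j` is a nonzerodivisor modulo any subfamily not containing it,
then, up to powers of `s`, all the relations of `v` are Koszul relations. -/
theorem exists_pow_smul_mem_koszulRelations {S κ : Type*} [CommRing S] [Fintype κ] (s : S)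
    (v : κ → S)
    (hreg : ∀ (t : Finset κ) (j : κ), j ∉ t → ∀ x, x * v j ∈ Ideal.span (v '' t) →
      ∃ N : ℕ, s ^ N * x ∈ Ideal.span (v '' t))
    (x : κ → S) (hx : Fintype.linearCombination S v x = 0) :
    ∃ N : ℕ, s ^ N • x ∈ koszulRelations v := by
  classical
  -- Induct on a set `t` containing the support of the relation.
  suffices H : ∀ (t : Finset κ) (x : κ → S), (∀ i, i ∉ t → x i = 0) →
      Fintype.linearCombination S v x = 0 → ∃ N : ℕ, s ^ N • x ∈ koszulRelations v from
    H Finset.univ x (fun i hi => absurd (Finset.mem_univ i) hi) hx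
  intro t
  induction t using Finset.induction_on with
  | empty =>
    intro x h0 _
    have : x = 0 := funext fun i => h0 i (Finset.notMem_empty i)
    exact ⟨0, by rw [this, smul_zero]; exact zero_mem _⟩
  | insert j t hj ih =>
    intro x h0 hx
    have hmem : x j * v j ∈ Ideal.span (v '' t) := by
      have h1 : x j * v j = -∑ i ∈ t, x i * v i := by
        rw [Fintype.linearCombination_apply, ← Finset.sum_subset (Finset.subset_univ (insert j t))
          (fun i _ hi => by rw [h0 i hi, zero_smul]), Finset.sum_insert hj] at hx
        exact eq_neg_of_add_eq_zero_left hx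
      rw [h1]
      exact neg_mem (sum_mem fun i hi =>
        Ideal.mul_mem_left _ _ (Ideal.subset_span ⟨i, hi, rfl⟩))
    obtain ⟨N, hN⟩ := hreg t j hj _ hmem
    obtain ⟨c, hc0, hc⟩ : ∃ c : κ → S, (∀ i, i ∉ t → c i = 0) ∧
        Fintype.linearCombination S v c = s ^ N * x j := by
      refine Submodule.span_induction ?_ ?_ ?_ ?_ hN
      · rintro _ ⟨i, hi, rfl⟩
        refine ⟨Pi.single i 1, fun k hk => Pi.single_eq_of_ne (by rintro rfl; exact hk hi) _, ?_⟩
        rw [Fintype.linearCombination_apply_single, one_smul]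
      · exact ⟨0, fun _ _ => rfl, map_zero _⟩
      · rintro _ _ _ _ ⟨a, ha, rfl⟩ ⟨b, hb, rfl⟩
        exact ⟨a + b, fun i hi => by rw [Pi.add_apply, ha i hi, hb i hi, add_zero], map_add _ _ _⟩
      · rintro r _ _ ⟨a, ha, rfl⟩
        exact ⟨r • a, fun i hi => by rw [Pi.smul_apply, ha i hi, smul_zero], map_smul _ _ _⟩
    set e : κ → S := Pi.single j 1 with he
    have hve : Fintype.linearCombination S v e = v j := by
      rw [he, Fintype.linearCombination_apply_single, one_smul]
    -- Since `c j = 0`, this Koszul relation has the same `j`-th coordinate as `s ^ N • x`;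
    -- subtracting it leaves a relation supported on `t`.
    have hK : (s ^ N * x j) • e - v j • c ∈ koszulRelations v :=
      Submodule.subset_span ⟨c, e, by rw [hc, hve]⟩
    obtain ⟨M, hM⟩ := ih (s ^ N • x - ((s ^ N * x j) • e - v j • c)) (fun i hi => by
        by_cases hij : i = j
        · subst hij
          simp [he, hc0 i hi]
        · simp [he, hc0 i hi, Pi.single_eq_of_ne hij,
            h0 i (fun h => (Finset.mem_insert.1 h).elim hij hi)])
      (by
        simp only [map_sub, map_smul, hx, hc, hve, smul_eq_mul]
        ring)
    refine ⟨M + N, ?_⟩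
    have := add_mem hM (Submodule.smul_mem _ (s ^ M) hK)
    rwa [← smul_add, sub_add_cancel, smul_smul, ← pow_add] at this

/-! ### Eliminating the variables of the elements `s Xᵢ - bᵢ` -/

namespace MvPolynomial

variable {A τ κ : Type*} [CommRing A]

/-- Up to powers of `s`, every polynomial is congruent modulo the `s * X (e i) - b i`, `i ∈ t`,
to a polynomial that does not involve the variables `X (e i)`, `i ∈ t`. -/
theorem exists_pow_mul_sub_mem_span [Nontrivial A] (e : κ → τ) (s : MvPolynomial τ A) (b : κ → MvPolynomial τ A)
    (hs : s ∈ supported A (Set.range e)ᶜ) (hb : ∀ i, b i ∈ supported A (Set.range e)ᶜ)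
    (t : Set κ) (p : MvPolynomial τ A) :
    ∃ N : ℕ, ∃ q ∈ supported A (e '' t)ᶜ,
      s ^ N * p - q ∈ Ideal.span ((fun i => s * X (e i) - b i) '' t) := by
  have hle : supported A (Set.range e)ᶜ ≤ supported A (e '' t)ᶜ :=
    supported_mono (Set.compl_subset_compl.2 (Set.image_subset_range e t))
  induction p using MvPolynomial.induction_on with
  | C a =>
    exact ⟨0, C a, Subalgebra.algebraMap_mem _ a, by simp⟩
  | add p₁ p₂ h₁ h₂ =>
    obtain ⟨N, q, hq, h⟩ := h₁
    obtain ⟨N', q', hq', h'⟩ := h₂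
    refine ⟨N + N', s ^ N' * q + s ^ N * q', add_mem (mul_mem (pow_mem (hle hs) _) hq)
      (mul_mem (pow_mem (hle hs) _) hq'), ?_⟩
    have := add_mem (Ideal.mul_mem_left _ (s ^ N') h) (Ideal.mul_mem_left _ (s ^ N) h')
    convert this using 1
    ring
  | mul_X p n h =>
    obtain ⟨N, q, hq, h⟩ := h
    by_cases hn : n ∈ e '' t
    · obtain ⟨i, hi, rfl⟩ := hn
      -- `s^(N+1) p Xᵢ - bᵢ q = s^N p (s Xᵢ - bᵢ) + bᵢ (s^N p - q)`, where `Xᵢ` stands for `X (e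
      -- i)`.
      refine ⟨N + 1, b i * q, mul_mem (hle (hb i)) hq, ?_⟩
      have := add_mem (Ideal.mul_mem_left _ (s ^ N * p)
        (Ideal.subset_span (Set.mem_image_of_mem (fun i => s * X (e i) - b i) hi)))
        (Ideal.mul_mem_left _ (b i) h)
      convert this using 1
      ring
    · refine ⟨N, q * X n, mul_mem hq (X_mem_supported.2 hn), ?_⟩
      have := Ideal.mul_mem_left _ (X n) h
      convert this using 1
      ring

/-- Up to powers of `s`, the elements `s * X (e i) - b i` form a regular sequence in any order. -/
theorem exists_pow_mul_mem_span_of_mul_mem [IsDomain A] {e : κ → τ} (he : Function.Injective e)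
    {s : MvPolynomial τ A} (hs0 : s ≠ 0) {b : κ → MvPolynomial τ A}
    (hs : s ∈ supported A (Set.range e)ᶜ) (hb : ∀ i, b i ∈ supported A (Set.range e)ᶜ)
    (t : Set κ) (j : κ) (hj : j ∉ t) (x : MvPolynomial τ A)
    (hx : x * (s * X (e j) - b j) ∈ Ideal.span ((fun i => s * X (e i) - b i) '' t)) :
    ∃ N : ℕ, s ^ N * x ∈ Ideal.span ((fun i => s * X (e i) - b i) '' t) := by
  classical
  let L := FractionRing (MvPolynomial τ A)
  let ι : MvPolynomial τ A →ₐ[A] L := IsScalarTower.toAlgHom A (MvPolynomial τ A) L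
  have hι : Function.Injective ι := IsFractionRing.injective _ _
  -- Substitute `X (e i) ↦ b i / s` for `i ∈ t` and fix the other variables: this kills the span and
  -- is injective on polynomials in the other variables.
  let y : τ → L := fun n => if h : n ∈ e '' t then ι (b h.choose) / ι s else ι (X n)
  let θ : MvPolynomial τ A →ₐ[A] L := aeval y
  have hθ (q : MvPolynomial τ A) (hq : q ∈ supported A (e '' t)ᶜ) : θ q = ι q := by
    rw [supported_eq_adjoin_X] at hq
    induction hq using Algebra.adjoin_induction with
    | mem q hq =>
      obtain ⟨n, hn, rfl⟩ := hq
      rw [aeval_X]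
      exact dif_neg hn
    | algebraMap r => rw [AlgHom.commutes, AlgHom.commutes]
    | add p q _ _ hp hq => rw [map_add, map_add, hp, hq]
    | mul p q _ _ hp hq => rw [map_mul, map_mul, hp, hq]
  have hle : supported A (Set.range e)ᶜ ≤ supported A (e '' t)ᶜ :=
    supported_mono (Set.compl_subset_compl.2 (Set.image_subset_range e t))
  have hspan (p : MvPolynomial τ A)
      (hp : p ∈ Ideal.span ((fun i => s * X (e i) - b i) '' t)) : θ p = 0 := by
    have : Ideal.span ((fun i => s * X (e i) - b i) '' t) ≤ RingHom.ker θ := by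
      rw [Ideal.span_le]
      rintro _ ⟨i, hi, rfl⟩
      have hmem : e i ∈ e '' t := ⟨i, hi, rfl⟩
      have hch : hmem.choose = i := he hmem.choose_spec.2
      have hy : θ (X (e i)) = ι (b i) / ι s := by
        rw [aeval_X]
        change dite _ _ _ = _
        rw [dif_pos hmem, hch]
      have hs' : ι s ≠ 0 := (map_ne_zero_iff ι hι).2 hs0
      rw [SetLike.mem_coe, RingHom.mem_ker]
      change θ (s * X (e i) - b i) = 0
      rw [map_sub, map_mul, hθ s (hle hs), hθ _ (hle (hb i)), hy, mul_div_cancel₀ _ hs', sub_self]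
    exact this hp
  -- The derivative with respect to `X (e j)` is `s ≠ 0`.
  have hj0 : s * X (e j) - b j ≠ 0 := by
    intro h
    have hd (q : MvPolynomial τ A) (hq : q ∈ supported A (Set.range e)ᶜ) :
        pderiv (e j) q = 0 :=
      pderiv_eq_zero_of_notMem_vars fun h => mem_supported.1 hq h ⟨j, rfl⟩
    have := congrArg (pderiv (e j)) h
    rw [map_sub, Derivation.leibniz, hd _ hs, hd _ (hb j), pderiv_X_self] at this
    simp [hs0] at this
  have hjt : s * X (e j) - b j ∈ supported A (e '' t)ᶜ :=
    sub_mem (mul_mem (hle hs) (X_mem_supported.2 fun ⟨i, hi, hij⟩ => hj (he hij ▸ hi))) (hle (hb j))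
  -- As `j ∉ t`, `θ` sends `s X (e j) - b j` to its nonzero image in the field `L`, so it can be
  -- cancelled.
  have hx0 : θ x = 0 := by
    have := hspan _ hx
    rw [map_mul, hθ _ hjt] at this
    exact (mul_eq_zero.1 this).resolve_right ((map_ne_zero_iff ι hι).2 hj0)
  obtain ⟨N, q, hq, h⟩ := exists_pow_mul_sub_mem_span e s b hs hb t x
  have hq0 : q = 0 := by
    have := hspan _ h
    rw [map_sub, map_mul, hx0, mul_zero, zero_sub, neg_eq_zero, hθ q hq] at this
    exact (map_eq_zero_iff ι hι).1 this
  exact ⟨N, by rwa [hq0, sub_zero] at h⟩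

end MvPolynomial

open MvPolynomial in
/-- Let `f : A[X_τ] → R` be a surjection onto a domain whose kernel contains the elements
`s * X (e i) - b i` and no nonzero polynomial in the variables outside the range of `e`.
Then `rank H₁(u) + #κ = #u` for every finite generating family `u` of the kernel. -/
theorem koszulHomologyRank_one_add_card_of_linear {A R : Type v} {τ κ : Type} [CommRing A]
    [IsDomain A] [CommRing R] [IsDomain R] [Fintype κ]
    (f : MvPolynomial τ A →+* R) (hf : Function.Surjective f)
    {n : ℕ} (u : Fin n → MvPolynomial τ A) (hu : Ideal.span (Set.range u) = RingHom.ker f)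
    {e : κ → τ} (he : Function.Injective e) {s : MvPolynomial τ A} (hs0 : s ≠ 0)
    {b : κ → MvPolynomial τ A}
    (hs : s ∈ supported A (Set.range e)ᶜ) (hb : ∀ i, b i ∈ supported A (Set.range e)ᶜ)
    (hker : ∀ i, f (s * X (e i) - b i) = 0)
    (hinj : ∀ q ∈ supported A (Set.range e)ᶜ, f q = 0 → q = 0) :
    koszulHomologyRank f hf u hu 1 + (Fintype.card κ : Cardinal) = (n : Cardinal) := by
  have hfs (N : ℕ) : f (s ^ N) ≠ 0 := by
    rw [map_pow]
    exact pow_ne_zero _ fun h => hs0 (hinj s hs h)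
  refine koszulHomologyRank_one_add_card f hf u hu (fun i => s * X (e i) - b i) hker ?_ ?_
  · intro p hp
    obtain ⟨N, q, hq, h⟩ := exists_pow_mul_sub_mem_span e s b hs hb Set.univ p
    rw [Set.image_univ] at h hq
    have hle : Ideal.span (Set.range fun i => s * X (e i) - b i) ≤ RingHom.ker f := by
      rw [Ideal.span_le]
      rintro _ ⟨i, rfl⟩
      exact hker i
    have hq0 : f q = 0 := by
      have := hle h
      rwa [RingHom.mem_ker, map_sub, map_mul, hp, mul_zero, zero_sub, neg_eq_zero] at this
    rw [hinj q hq hq0, sub_zero] at h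
    exact ⟨_, hfs N, h⟩
  · intro x hx
    obtain ⟨N, hN⟩ := exists_pow_smul_mem_koszulRelations s (fun i => s * X (e i) - b i)
      (fun t j hj y hy => exists_pow_mul_mem_span_of_mul_mem he hs0 hs hb t j hj y hy) x hx
    exact ⟨_, hfs N, hN⟩

/-! ### The two Rees presentations -/

theorem MvPolynomial.eq_zero_of_mem_supported_singleton {A B τ : Type*} [CommRing A] [CommRing B]
    [Algebra A B] (f : MvPolynomial τ A →ₐ[A] B) (o : τ)
    (ho : ∀ q : Polynomial A, Polynomial.aeval (f (X o)) q = 0 → q = 0) {p : MvPolynomial τ A}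
    (hp : p ∈ supported A {o}) (h : f p = 0) : p = 0 := by
  rw [supported_eq_adjoin_X, Set.image_singleton, Algebra.adjoin_singleton_eq_range_aeval] at hp
  obtain ⟨q, rfl⟩ := hp
  have h' : f (Polynomial.aeval (X o) q) = 0 := h
  rw [← Polynomial.aeval_algHom_apply] at h'
  rw [ho q h', map_zero]

theorem Polynomial.eq_zero_of_aeval_monomial_one {A : Type*} [CommRing A] [IsDomain A] {a : A}
    (ha : a ≠ 0) (q : Polynomial A) (h : Polynomial.aeval (Polynomial.monomial 1 a) q = 0) :
    q = 0 := by
  ext n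
  have := congrArg (fun p => Polynomial.coeff p n) h
  -- Substituting `a X` multiplies the `n`-th coefficient by `a ^ n`.
  rw [← Polynomial.C_mul_X_eq_monomial] at this
  change (q.comp (Polynomial.C a * Polynomial.X)).coeff n = _ at this
  rw [Polynomial.comp_C_mul_X_coeff, Polynomial.coeff_zero] at this
  exact (mul_eq_zero.1 this).resolve_right (pow_ne_zero _ ha)

theorem LaurentPolynomial.eq_zero_of_aeval_T_neg_one {A : Type*} [CommRing A] (q : Polynomial A)
    (h : Polynomial.aeval (LaurentPolynomial.T (-1) : A[T;T⁻¹]) q = 0) : q = 0 := by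
  have : (Polynomial.aeval (LaurentPolynomial.T (-1) : A[T;T⁻¹])) =
      (LaurentPolynomial.invert (R := A)).toAlgHom.comp Polynomial.toLaurentAlg := by
    ext
    simp
  rw [this] at h
  have h' : LaurentPolynomial.invert (R := A) (Polynomial.toLaurent q) = 0 := h
  rw [map_eq_zero_iff _ (LaurentPolynomial.invert (R := A)).injective] at h'
  exact (map_eq_zero_iff _ Polynomial.toLaurent_injective).1 h'

/-- All `r` variables `Xᵢ` are eliminated by `T Xᵢ - aᵢ`; only `T` remains, and `t⁻¹` is
transcendental over `A`. -/
theorem koszulHomologyRank_extendedRees_add {A : Type v} [CommRing A] [IsDomain A] {I : Ideal A}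
    {r n : ℕ} (a : Fin r → A) (ha : Ideal.span (Set.range a) = I)
    (u : Fin n → MvPolynomial (Option (Fin r)) A)
    (hu : Ideal.span (Set.range u) = extendedReesIdeal a ha) :
    koszulHomologyRank (extendedReesPresentation a ha).toRingHom
      (extendedReesPresentation_surjective a ha) u hu 1 + (r : Cardinal) = (n : Cardinal) := by
  have hcompl : (Set.range (some : Fin r → Option (Fin r)))ᶜ = {none} := by
    ext x; cases x <;> simp
  have hX (i : Fin r) : ((extendedReesPresentation a ha (MvPolynomial.X (some i)) :
      extendedReesAlgebra I) : A[T;T⁻¹]) =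
      LaurentPolynomial.C (a i) * LaurentPolynomial.T 1 := by
    simp [extendedReesPresentation]
  have hT : ((extendedReesPresentation a ha (MvPolynomial.X none) :
      extendedReesAlgebra I) : A[T;T⁻¹]) = LaurentPolynomial.T (-1) := by
    simp [extendedReesPresentation]
  have := koszulHomologyRank_one_add_card_of_linear (extendedReesPresentation a ha).toRingHom
    (extendedReesPresentation_surjective a ha) u hu (e := some) (Option.some_injective (Fin r))
    (s := MvPolynomial.X none) (b := fun i => MvPolynomial.C (a i)) (MvPolynomial.X_ne_zero _)
    (by rw [hcompl]; exact MvPolynomial.X_mem_supported.2 rfl)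
    (fun i => Subalgebra.algebraMap_mem _ (a i)) ?_ ?_
  · rwa [Fintype.card_fin] at this
  · intro i
    apply Subtype.ext
    change ((extendedReesPresentation a ha _ : extendedReesAlgebra I) : A[T;T⁻¹]) = 0
    rw [map_sub, map_mul, Subalgebra.coe_sub, Subalgebra.coe_mul, hX, hT, sub_eq_zero,
      mul_left_comm, ← LaurentPolynomial.T_add, neg_add_cancel, LaurentPolynomial.T_zero, mul_one]
    have := (extendedReesPresentation a ha).commutes (a i)
    exact (congrArg Subtype.val this).symm
  · intro q hq hq0
    rw [hcompl] at hq
    refine MvPolynomial.eq_zero_of_mem_supported_singleton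
      ((extendedReesAlgebra I).val.comp (extendedReesPresentation a ha)) none ?_ hq
      (congrArg Subtype.val hq0)
    intro p hp
    refine LaurentPolynomial.eq_zero_of_aeval_T_neg_one p ?_
    rw [← hT]
    exact hp

/-- The variable `X_o` with `a_o ≠ 0` survives, and `a_o t` is transcendental over `A`. Only `r - 1`
variables are eliminated, which accounts for the extra `1`. -/
theorem koszulHomologyRank_rees_add {A : Type v} [CommRing A] [IsDomain A] {I : Ideal A}
    (hI : I ≠ ⊥) {r n : ℕ} (a : Fin r → A) (ha : Ideal.span (Set.range a) = I)
    (u : Fin n → MvPolynomial (Fin r) A)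
    (hu : Ideal.span (Set.range u) = reesIdeal a ha) :
    koszulHomologyRank (reesPresentation a ha).toRingHom
      (reesPresentation_surjective a ha) u hu 1 + (r : Cardinal) = (n : Cardinal) + 1 := by
  obtain ⟨o, ho⟩ : ∃ o, a o ≠ 0 := by
    by_contra! h
    apply hI
    rw [← ha, Ideal.span_eq_bot]
    rintro _ ⟨i, rfl⟩
    exact h i
  have hcompl : (Set.range (Subtype.val : {i : Fin r // i ≠ o} → Fin r))ᶜ = {o} := by
    ext x; simp
  have hX (i : Fin r) : ((reesPresentation a ha (MvPolynomial.X i) : reesAlgebra I) :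
      Polynomial A) = Polynomial.monomial 1 (a i) := by
    simp [reesPresentation]
  have hC (c : A) : ((reesPresentation a ha (MvPolynomial.C c) : reesAlgebra I) :
      Polynomial A) = Polynomial.C c :=
    congrArg Subtype.val ((reesPresentation a ha).commutes c)
  have := koszulHomologyRank_one_add_card_of_linear (reesPresentation a ha).toRingHom
    (reesPresentation_surjective a ha) u hu (e := (Subtype.val : {i : Fin r // i ≠ o} → Fin r))
    Subtype.val_injective (s := MvPolynomial.C (a o))
    (b := fun i => MvPolynomial.C (a i) * MvPolynomial.X o)
    (by rwa [Ne, MvPolynomial.C_eq_zero])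
    (Subalgebra.algebraMap_mem _ (a o))
    (fun i => mul_mem (Subalgebra.algebraMap_mem _ (a i))
      (by rw [hcompl]; exact MvPolynomial.X_mem_supported.2 rfl)) ?_ ?_
  · have hcard : Fintype.card {i : Fin r // i ≠ o} + 1 = r := by
      have hr := o.pos
      rw [Fintype.card_subtype_compl, Fintype.card_fin, Fintype.card_subtype_eq]
      omega
    rw [← this, add_assoc]
    congr 1
    exact_mod_cast hcard.symm
  · intro i
    apply Subtype.ext
    change ((reesPresentation a ha _ : reesAlgebra I) : Polynomial A) = 0
    rw [map_sub, map_mul, map_mul, Subalgebra.coe_sub, Subalgebra.coe_mul, Subalgebra.coe_mul,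
      hX, hX, hC, hC, Polynomial.C_mul_monomial, Polynomial.C_mul_monomial, mul_comm, sub_self]
  · intro q hq hq0
    rw [hcompl] at hq
    refine MvPolynomial.eq_zero_of_mem_supported_singleton
      ((reesAlgebra I).val.comp (reesPresentation a ha)) o ?_ hq (congrArg Subtype.val hq0)
    intro p hp
    refine Polynomial.eq_zero_of_aeval_monomial_one ho p ?_
    rw [← hX]
    exact hp

theorem theorem1p3 {A : Type*} [CommRing A] [IsDomain A] [IsLocalRing A] [IsNoetherianRing A]
    [IsCohenMacaulayLocal A] (hd : 1 ≤ ringKrullDim A) (I : Ideal A) (hI : I ≠ ⊥)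
    (a : Fin I.spanFinrank → A) (ha : Ideal.span (Set.range a) = I) :
    (∀ (u : Fin (extendedReesIdeal a ha).spanFinrank → MvPolynomial (Option (Fin I.spanFinrank)) A)
        (hu : Ideal.span (Set.range u) = extendedReesIdeal a ha),
      koszulHomologyRank (extendedReesPresentation a ha).toRingHom
          (extendedReesPresentation_surjective a ha) u hu 1 + (I.spanFinrank : Cardinal) =
        ((extendedReesIdeal a ha).spanFinrank : Cardinal)) ∧
    (∀ (u : Fin (reesIdeal a ha).spanFinrank → MvPolynomial (Fin I.spanFinrank) A)
        (hu : Ideal.span (Set.range u) = reesIdeal a ha),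
      koszulHomologyRank (reesPresentation a ha).toRingHom
          (reesPresentation_surjective a ha) u hu 1 + (I.spanFinrank : Cardinal) =
        ((reesIdeal a ha).spanFinrank : Cardinal) + 1) :=
  ⟨fun u hu => koszulHomologyRank_extendedRees_add a ha u hu,
    fun u hu => koszulHomologyRank_rees_add hI a ha u hu⟩
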